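/- Let $c>0$ and $\alpha>1/2$ be real numbers, and consider on $(0,1)$ the differential operator $$\mathcal D_c^{\alpha}\varphi(x)=\frac{d}{dx}\Big[(1-x^2)\varphi'(x)\Big]+\Big(\frac{\frac14-\alpha^2}{x^2}-c^2x^2\Big)\varphi(x).$$ A real number $\chi$ is an eigenvalue of $-\mathcal D_c^{\alpha}$ if $-\mathcal D_c^{\alpha}\varphi=\chi\varphi$ on $(0,1)$ for some bounded, not identically zero $C^2$ function $\varphi:(0,1)\to\mathbb R$ (an eigenfunction). Let $\chi_{n,\alpha}(c)$, $n=0,1,2,\dots$, denote the eigenvalues in increasing order, numbered from $0$, and let $\varphi_{n,c}^{(\alpha)}$ (the $n$-th circular prolate spheroidal wave function) be an eigenfunction for $\chi_{n,\alpha}(c)$. Let $n\ge 1$ be an integer such that $\chi_{n,\alpha}(c)\ge 2c\sqrt{\alpha^2-\frac14}$. Then $\varphi_{n,c}^{(\alpha)}$ has a first (smallest) zero $x_{1,n}$ in $(0,1)$, and $$\sqrt{\frac{\alpha^2-\frac14}{\chi_{n,\alpha}(c)}}\le x_{1,n}.$$ If moreover $\chi_{n,\alpha}(c)\ge c^2+\alpha^2-\frac14$,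 then also $$x_{1,n}\le\frac{\pi+\frac{\pi}{2}\alpha-\frac34}{\sqrt{\chi_{n,\alpha}(c)-(\alpha^2-\frac14)}}.$$ -/

import Mathlib

open Set

namespace CircularProlate

/-- The differential operator
`D φ (x) = d/dx [(1 - x²) φ'(x)] + ((1/4 - α²)/x² - c² x²) φ(x)`. -/
noncomputable def diffOp (α c : ℝ) (φ : ℝ → ℝ) (x : ℝ) : ℝ :=
  deriv (fun t => (1 - t ^ 2) * deriv φ t) x + ((1 / 4 - α ^ 2) / x ^ 2 - c ^ 2 * x ^ 2) * φ x

/-- `φ` is a bounded eigenfunction of `-D` on `(0,1)` with eigenvalue `χ`: a bounded, not identically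
zero `C²` function on `(0,1)` with `-D φ = χ φ` there. Values of `φ` outside `(0,1)` play no role. -/
structure IsBoundedEigenfunction (α c χ : ℝ) (φ : ℝ → ℝ) : Prop where
  contDiffOn : ContDiffOn ℝ 2 φ (Ioo 0 1)
  bounded : ∃ M : ℝ, ∀ x ∈ Ioo (0 : ℝ) 1, |φ x| ≤ M
  nontrivial : ∃ x ∈ Ioo (0 : ℝ) 1, φ x ≠ 0
  eigen : ∀ x ∈ Ioo (0 : ℝ) 1, -diffOp α c φ x = χ * φ x

/-- The set of eigenvalues of `-D` (for bounded eigenfunctions). -/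
def eigenvalues (α c : ℝ) : Set ℝ :=
  {χ | ∃ φ, IsBoundedEigenfunction α c χ φ}

/-- `χ` is the `n`-th eigenvalue `χ_{n,α}(c)` of `-D`; the eigenvalues are listed increasingly and
numbered from `0`, so exactly `n` of them are smaller than `χ`. -/
def IsNthEigenvalue (n : ℕ) (α c χ : ℝ) : Prop :=
  χ ∈ eigenvalues α c ∧ {χ' ∈ eigenvalues α c | χ' < χ}.encard = n

/-- `φ` is (a nonzero multiple of) the `n`-th circular prolate spheroidal wave function
`φ_{n,c}^{(α)}`, with eigenvalue `χ = χ_{n,α}(c)`. No normalization is imposed. -/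
def IsCPSWF (n : ℕ) (α c χ : ℝ) (φ : ℝ → ℝ) : Prop :=
  IsNthEigenvalue n α c χ ∧ IsBoundedEigenfunction α c χ φ

end CircularProlate

/-!
Put `a = α² - 1/4` and let `g = (1 - x²) φ'` be the flux of an eigenfunction `φ`, so that
`g' = V φ` with `V = a / x² + c² x² - χ`.

*Endpoints.* Near `0` the potential `V` is at least `a / (2 x²)`. Hence `φ g` increases, and
boundedness of `φ` forces `φ g ≥ 0`, `φ → 0` and `g = O(1)` there
(`IsSolutionPair.tendsto_zero_and_bounded`). Near `1` boundedness forces `g → 0`, since otherwise `φ`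
would grow logarithmically (`IsSolutionPair.tendsto_snd_one`). The boundary terms in the next two
steps vanish for these reasons.

*Existence of a zero.* As `n ≥ 1`, there is a bounded eigenfunction for a smaller eigenvalue. The
Wronskian of the two vanishes at both endpoints, and Sturm comparison yields a zero of `φ`
(`IsSolutionPair.exists_zero`).

*Lower bound.* Where `x² < a / χ` the potential is positive, so `φ g` increases from its limit `0` and
can vanish again only if `φ` is identically zero (`IsSolutionPair.le_mul_sq_of_eq_zero`). In
particular the zeros do not accumulate at `0`, and a smallest one exists.

*Upper bound.* Write `φ = x^(α+1/2) (1 - x²)^(-1/2) v`. If `c² + a ≤ χ`, then `h = v' / v` satisfies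
`h' + h² + (2α+1) h / x ≤ -(χ - a)`, the Riccati inequality comparing `φ` with the Bessel function
`J_α(√(χ - a) x)`. As long as `φ` has no zero, it forces `h ≤ 0`, which controls the boundary term at
`0` (`IsSolutionPair.logDerivative_nonpos`). If `φ` had no zero on `(0, X]`, Picone's identity would
bound below by `χ - a` the Rayleigh quotient of every trial function on `(0, X)`
(`IsSolutionPair.exists_zero_le`). For
`√(χ - a) X = π + (π/2) α - 3/4` the trial function `(1 - y)(1 - y/2)`, `y = (x/X)²`, contradicts this
(`trialEnergy_one_neg`).
-/

open Filter Topology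

namespace CircularProlate

/-! ### Calculus on closed intervals -/

lemma le_of_hasDerivAt_nonneg {f f' : ℝ → ℝ} {p q : ℝ} (hpq : p ≤ q)
    (hd : ∀ x ∈ Icc p q, HasDerivAt f (f' x) x) (h : ∀ x ∈ Icc p q, 0 ≤ f' x) : f p ≤ f q := by
  have hm : MonotoneOn f (Icc p q) := by
    refine monotoneOn_of_deriv_nonneg (convex_Icc p q)
      (fun x hx => (hd x hx).continuousAt.continuousWithinAt)
      (fun x hx => (hd x (interior_subset hx)).differentiableAt.differentiableWithinAt) ?_
    intro x hx
    rw [(hd x (interior_subset hx)).deriv]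
    exact h x (interior_subset hx)
  exact hm (left_mem_Icc.2 hpq) (right_mem_Icc.2 hpq) hpq

lemma le_of_hasDerivAt_nonpos {f f' : ℝ → ℝ} {p q : ℝ} (hpq : p ≤ q)
    (hd : ∀ x ∈ Icc p q, HasDerivAt f (f' x) x) (h : ∀ x ∈ Icc p q, f' x ≤ 0) : f q ≤ f p := by
  have := le_of_hasDerivAt_nonneg (f := fun x => -f x) (f' := fun x => -f' x) hpq
    (fun x hx => (hd x hx).neg) (fun x hx => by simpa using h x hx)
  linarith

lemma lt_of_hasDerivAt_neg {f f' : ℝ → ℝ} {p q : ℝ} (hpq : p < q)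
    (hd : ∀ x ∈ Icc p q, HasDerivAt f (f' x) x) (h : ∀ x ∈ Icc p q, f' x < 0) : f q < f p := by
  have hm : StrictAntiOn f (Icc p q) := by
    refine strictAntiOn_of_deriv_neg (convex_Icc p q)
      (fun x hx => (hd x hx).continuousAt.continuousWithinAt) ?_
    intro x hx
    rw [(hd x (interior_subset hx)).deriv]
    exact h x (interior_subset hx)
  exact hm (left_mem_Icc.2 hpq.le) (right_mem_Icc.2 hpq.le) hpq

/-! ### The eigenvalue equation as a first order system -/

/-- The potential `V` for which `((1 - x²) φ')' = V φ` is the eigenvalue equation, where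
`a = α² - 1/4`. -/
noncomputable def potential (a c χ x : ℝ) : ℝ := a / x ^ 2 + c ^ 2 * x ^ 2 - χ

/-- The eigenvalue equation on `(0, 1)` as a first order system for `φ` and its flux
`g = (1 - x²) φ'`. -/
structure IsSolutionPair (a c χ : ℝ) (φ g : ℝ → ℝ) : Prop where
  hasDerivAt_fst : ∀ x ∈ Ioo (0 : ℝ) 1, HasDerivAt φ (g x / (1 - x ^ 2)) x
  hasDerivAt_snd : ∀ x ∈ Ioo (0 : ℝ) 1, HasDerivAt g (potential a c χ x * φ x) x

lemma one_sub_sq_pos {x : ℝ} (hx : x ∈ Ioo (0 : ℝ) 1) : 0 < 1 - x ^ 2 := by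
  have h0 := hx.1
  have h1 := hx.2
  nlinarith

lemma IsBoundedEigenfunction.isSolutionPair {α c χ : ℝ} {φ : ℝ → ℝ}
    (h : IsBoundedEigenfunction α c χ φ) :
    IsSolutionPair (α ^ 2 - 1 / 4) c χ φ (fun t => (1 - t ^ 2) * deriv φ t) := by
  have hdiff : DifferentiableOn ℝ φ (Ioo 0 1) := h.contDiffOn.differentiableOn (by norm_num)
  have hdiff' : DifferentiableOn ℝ (deriv φ) (Ioo 0 1) := by
    have : ContDiffOn ℝ 1 (deriv φ) (Ioo 0 1) :=
      h.contDiffOn.deriv_of_isOpen isOpen_Ioo (by norm_num)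
    exact this.differentiableOn (by norm_num)
  refine ⟨fun x hx => ?_, fun x hx => ?_⟩
  · have hp := one_sub_sq_pos hx
    have := (hdiff.differentiableAt (isOpen_Ioo.mem_nhds hx)).hasDerivAt
    exact this.congr_deriv (mul_div_cancel_left₀ _ hp.ne').symm
  · have hd := hdiff'.differentiableAt (isOpen_Ioo.mem_nhds hx)
    have hd' : DifferentiableAt ℝ (fun t => (1 - t ^ 2) * deriv φ t) x :=
      DifferentiableAt.mul (by fun_prop) hd
    have := hd'.hasDerivAt
    have he := h.eigen x hx
    unfold diffOp at he
    refine this.congr_deriv ?_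
    unfold potential
    have e : (1 / 4 - α ^ 2) / x ^ 2 = -((α ^ 2 - 1 / 4) / x ^ 2) := by ring
    rw [e] at he
    linarith

namespace IsSolutionPair

variable {a c χ : ℝ} {φ g : ℝ → ℝ}

lemma neg (h : IsSolutionPair a c χ φ g) :
    IsSolutionPair a c χ (fun x => -φ x) (fun x => -g x) := by
  refine ⟨fun x hx => ?_, fun x hx => ?_⟩
  · exact (h.hasDerivAt_fst x hx).neg.congr_deriv (by ring)
  · exact (h.hasDerivAt_snd x hx).neg.congr_deriv (by ring)

lemma hasDerivAt_mul (h : IsSolutionPair a c χ φ g) {x : ℝ} (hx : x ∈ Ioo (0 : ℝ) 1) :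
    HasDerivAt (fun t => φ t * g t)
      (g x ^ 2 / (1 - x ^ 2) + potential a c χ x * φ x ^ 2) x := by
  exact ((h.hasDerivAt_fst x hx).mul (h.hasDerivAt_snd x hx)).congr_deriv (by ring)

lemma hasDerivAt_sq (h : IsSolutionPair a c χ φ g) {x : ℝ} (hx : x ∈ Ioo (0 : ℝ) 1) :
    HasDerivAt (fun t => φ t ^ 2) (2 * (φ x * g x) / (1 - x ^ 2)) x := by
  exact ((h.hasDerivAt_fst x hx).pow 2).congr_deriv (by push_cast; ring)

/-! ### Behaviour at the endpoint `0` -/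

lemma exists_div_le_potential (ha : 0 < a) (c χ : ℝ) :
    ∃ x₀ ∈ Ioo (0 : ℝ) 1, ∀ x ∈ Ioc (0 : ℝ) x₀, a / 2 / x ^ 2 ≤ potential a c χ x := by
  have hpos : 0 < a / (2 * (|χ| + 1)) := by positivity
  refine ⟨min (1 / 2) (a / (2 * (|χ| + 1))), ⟨by positivity, ?_⟩, fun x hx => ?_⟩
  · exact lt_of_le_of_lt (min_le_left _ _) (by norm_num)
  · have hx1 : x ≤ 1 / 2 := hx.2.trans (min_le_left _ _)
    have hx2 : x ≤ a / (2 * (|χ| + 1)) := hx.2.trans (min_le_right _ _)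
    have hx0 := hx.1
    have h3 : x ^ 2 ≤ a / (2 * (|χ| + 1)) := by nlinarith
    have h4 : |χ| + 1 ≤ a / 2 / x ^ 2 := by
      rw [le_div_iff₀ (by positivity)] at h3 ⊢
      linarith
    have h5 : a / x ^ 2 = a / 2 / x ^ 2 + a / 2 / x ^ 2 := by ring
    unfold potential
    have := le_abs_self χ
    have : 0 ≤ c ^ 2 * x ^ 2 := by positivity
    linarith

/-- Where `φ² ≥ m` near `0`, the singular potential forces `φ g` down to `-∞` at the rate `1 / y`. -/
lemma mul_le_sub_div (h : IsSolutionPair a c χ φ g) (ha : 0 < a) {x₀ x m : ℝ} (hx₀ : x₀ < 1)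
    (hV : ∀ x ∈ Ioc (0 : ℝ) x₀, a / 2 / x ^ 2 ≤ potential a c χ x) (hx : x ∈ Ioc 0 x₀)
    (hm : ∀ y ∈ Ioc 0 x, m ≤ φ y ^ 2) {y : ℝ} (hy : y ∈ Ioc 0 x) :
    φ y * g y ≤ φ x * g x + a / 2 * m / x - a / 2 * m / y := by
  have key := le_of_hasDerivAt_nonneg (f := fun t => φ t * g t + a / 2 * m * t⁻¹) hy.2
    (fun t ht => (h.hasDerivAt_mul ⟨hy.1.trans_le ht.1, (ht.2.trans hx.2).trans_lt hx₀⟩).add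
      ((hasDerivAt_inv (hy.1.trans_le ht.1).ne').const_mul (a / 2 * m))) (fun t ht => by
      have ht0 := hy.1.trans_le ht.1
      have hp := one_sub_sq_pos (x := t) ⟨ht0, (ht.2.trans hx.2).trans_lt hx₀⟩
      have h1 := hV t ⟨ht0, ht.2.trans hx.2⟩
      have h2 := hm t ⟨ht0, ht.2⟩
      have h3 : 0 ≤ g t ^ 2 / (1 - t ^ 2) := by positivity
      have h4 : a / 2 / t ^ 2 * m ≤ potential a c χ t * φ t ^ 2 :=
        (mul_le_mul_of_nonneg_left h2 (by positivity)).trans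
          (mul_le_mul_of_nonneg_right h1 (by positivity))
      have h5 : a / 2 * m * -(t ^ 2)⁻¹ = -(a / 2 / t ^ 2 * m) := by ring
      rw [h5]
      linarith)
  simp only [← div_eq_mul_inv] at key
  linarith

/-- Near `0`, `φ g` is nonnegative for bounded `φ`: otherwise `φ²` would increase towards `0`, and
then diverge logarithmically. -/
lemma mul_nonneg_of_bounded (h : IsSolutionPair a c χ φ g) (ha : 0 < a) {M : ℝ}
    (hM : ∀ x ∈ Ioo (0 : ℝ) 1, |φ x| ≤ M) {x₀ : ℝ} (hx₀ : x₀ < 1)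
    (hV : ∀ x ∈ Ioc (0 : ℝ) x₀, a / 2 / x ^ 2 ≤ potential a c χ x) {x : ℝ} (hx : x ∈ Ioc 0 x₀) :
    0 ≤ φ x * g x := by
  by_contra! hneg
  have hx0 := hx.1
  have hmem : ∀ t ∈ Ioc 0 x, t ∈ Ioo (0 : ℝ) 1 :=
    fun t ht => ⟨ht.1, (ht.2.trans hx.2).trans_lt hx₀⟩
  have hE : ∀ y ∈ Ioc 0 x, φ y * g y ≤ φ x * g x := fun y hy => by
    simpa using h.mul_le_sub_div ha (m := 0) hx₀ hV hx (fun t _ => sq_nonneg _) hy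
  have hmono : ∀ y ∈ Ioc 0 x, φ x ^ 2 ≤ φ y ^ 2 := fun y hy =>
    le_of_hasDerivAt_nonpos (f := fun t => φ t ^ 2) hy.2
      (fun t ht => h.hasDerivAt_sq (hmem t ⟨hy.1.trans_le ht.1, ht.2⟩)) (fun t ht => by
        have ht' : t ∈ Ioc 0 x := ⟨hy.1.trans_le ht.1, ht.2⟩
        have hp := one_sub_sq_pos (hmem t ht')
        exact div_nonpos_of_nonpos_of_nonneg (by linarith [hE t ht']) hp.le)
  have hφx : 0 < φ x ^ 2 := by
    have : φ x ≠ 0 := by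
      rintro h0
      simp [h0] at hneg
    positivity
  set C := a / 2 * φ x ^ 2 with hC
  have hCpos : 0 < C := by positivity
  set K := C / x with hK
  have hE' : ∀ y ∈ Ioc 0 x, φ y * g y ≤ K - C / y := fun y hy => by
    have := h.mul_le_sub_div ha hx₀ hV hx hmono hy
    linarith
  -- the derivative of `φ²` is at most `2 (K - C / t)`, as `K - C / t ≤ 0` and `1 - t² ≤ 1`
  have hlog : ∀ y ∈ Ioc 0 x, φ x ^ 2 - 2 * K * x + 2 * C * Real.log x ≤
      φ y ^ 2 - 2 * K * y + 2 * C * Real.log y := fun y hy =>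
    le_of_hasDerivAt_nonpos (f := fun t => φ t ^ 2 - 2 * K * t + 2 * C * Real.log t) hy.2
      (fun t ht => ((h.hasDerivAt_sq (hmem t ⟨hy.1.trans_le ht.1, ht.2⟩)).sub
        ((hasDerivAt_id t).const_mul (2 * K))).add
        ((Real.hasDerivAt_log (hy.1.trans_le ht.1).ne').const_mul (2 * C))) (fun t ht => by
        have ht' : t ∈ Ioc 0 x := ⟨hy.1.trans_le ht.1, ht.2⟩
        have hp := one_sub_sq_pos (hmem t ht')
        have h1 : K - C / t ≤ 0 := by
          have : C / x ≤ C / t := div_le_div_of_nonneg_left hCpos.le ht'.1 ht'.2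
          linarith
        have h2 : 2 * (φ t * g t) / (1 - t ^ 2) ≤ 2 * (K - C / t) := by
          rw [div_le_iff₀ hp]
          nlinarith [hE' t ht', sq_nonneg t]
        have h3 : 2 * C * t⁻¹ = 2 * (C / t) := by ring
        rw [h3]
        linarith)
  have hMx := hM x (hmem x ⟨hx0, le_rfl⟩)
  have hM0 : 0 ≤ M := (abs_nonneg _).trans hMx
  -- at `y = x exp (-R)` the logarithm exceeds the bound `M²`
  set R := (M ^ 2 + 2 * C) / (2 * C) with hR
  have hRpos : 0 ≤ R := by positivity
  have hy : x * Real.exp (-R) ∈ Ioc 0 x :=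
    ⟨by positivity, mul_le_of_le_one_right hx0.le (by simpa using hRpos)⟩
  have h1 := hlog _ hy
  rw [Real.log_mul hx0.ne' (Real.exp_pos _).ne', Real.log_exp] at h1
  have h2 : φ (x * Real.exp (-R)) ^ 2 ≤ M ^ 2 := sq_le_sq' (by
    linarith [(abs_le.1 (hM _ (hmem _ hy))).1]) (abs_le.1 (hM _ (hmem _ hy))).2
  have h3 : 2 * C * R = M ^ 2 + 2 * C := by rw [hR]; field_simp
  have h4 : K * x = C := by rw [hK]; field_simp
  have h5 : 0 ≤ K * (x * Real.exp (-R)) := by positivity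
  nlinarith

/-- At the singular endpoint `0`, bounded solutions tend to `0` and have bounded flux. -/
lemma tendsto_zero_and_bounded (h : IsSolutionPair a c χ φ g) (ha : 0 < a) {M : ℝ}
    (hM : ∀ x ∈ Ioo (0 : ℝ) 1, |φ x| ≤ M) :
    Tendsto φ (𝓝[>] 0) (𝓝 0) ∧ ∃ B, ∀ᶠ x in 𝓝[>] 0, |g x| ≤ B := by
  obtain ⟨x₀, hx₀, hV⟩ := exists_div_le_potential ha c χ
  have hmem : ∀ t ∈ Ioc 0 x₀, t ∈ Ioo (0 : ℝ) 1 :=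
    fun t ht => ⟨ht.1, ht.2.trans_lt hx₀.2⟩
  have hE : ∀ x ∈ Ioc 0 x₀, 0 ≤ φ x * g x :=
    fun x hx => h.mul_nonneg_of_bounded ha hM hx₀.2 hV hx
  have hmono : ∀ x ∈ Ioc 0 x₀, ∀ y ∈ Ioc 0 x, φ y ^ 2 ≤ φ x ^ 2 := fun x hx y hy =>
    le_of_hasDerivAt_nonneg (f := fun t => φ t ^ 2) hy.2
      (fun t ht => h.hasDerivAt_sq (hmem t ⟨hy.1.trans_le ht.1, ht.2.trans hx.2⟩))
      (fun t ht => by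
        have ht' : t ∈ Ioc 0 x₀ := ⟨hy.1.trans_le ht.1, ht.2.trans hx.2⟩
        exact div_nonneg (by linarith [hE t ht']) (one_sub_sq_pos (hmem t ht')).le)
  refine ⟨?_, |g x₀|, ?_⟩
  · rw [Metric.tendsto_nhds]
    intro ε hε
    obtain ⟨z, hz, hzε⟩ : ∃ z ∈ Ioc 0 x₀, φ z ^ 2 < ε ^ 2 := by
      by_contra! hcon
      set C := a / 2 * ε ^ 2 with hC
      have hCpos : 0 < C := by positivity
      have hE0 := hE x₀ ⟨hx₀.1, le_rfl⟩
      have hx₀' := hx₀.1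
      -- the point where the upper bound for `φ g` equals `-1`
      set K := φ x₀ * g x₀ + C / x₀ with hK
      have hKpos : 0 < K + 1 := by positivity
      have hy : C / (K + 1) ∈ Ioc 0 x₀ := by
        refine ⟨by positivity, ?_⟩
        rw [div_le_iff₀ hKpos]
        have : x₀ * (C / x₀) = C := by field_simp
        nlinarith [mul_nonneg hx₀'.le hE0]
      have h1 := h.mul_le_sub_div ha hx₀.2 hV ⟨hx₀.1, le_rfl⟩ hcon hy
      have h2 := hE _ hy
      have h3 : C / (C / (K + 1)) = K + 1 := by field_simp
      rw [h3] at h1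
      linarith
    filter_upwards [Ioo_mem_nhdsGT hz.1] with x hx
    rw [Real.dist_eq, sub_zero]
    exact abs_lt_of_sq_lt_sq ((hmono z hz x ⟨hx.1, hx.2.le⟩).trans_lt hzε) hε.le
  · filter_upwards [Ioo_mem_nhdsGT hx₀.1] with x hx
    rw [← sq_le_sq]
    refine le_of_hasDerivAt_nonneg (f := fun t => g t ^ 2) hx.2.le
      (fun t ht => (h.hasDerivAt_snd t (hmem t ⟨hx.1.trans_le ht.1, ht.2⟩)).pow 2)
      (fun t ht => ?_)
    have ht' : t ∈ Ioc 0 x₀ := ⟨hx.1.trans_le ht.1, ht.2⟩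
    have h1 : 0 ≤ potential a c χ t := le_trans (by positivity) (hV t ht')
    have := mul_nonneg h1 (hE t ht')
    simp
    linarith

lemma tendsto_mul_zero (h : IsSolutionPair a c χ φ g) (ha : 0 < a) {M : ℝ}
    (hM : ∀ x ∈ Ioo (0 : ℝ) 1, |φ x| ≤ M) {ψ : ℝ → ℝ} (hψ : Tendsto ψ (𝓝[>] 0) (𝓝 0)) :
    Tendsto (fun x => ψ x * g x) (𝓝[>] 0) (𝓝 0) := by
  obtain ⟨B, hB⟩ := (h.tendsto_zero_and_bounded ha hM).2
  exact hψ.zero_mul_isBoundedUnder_le ⟨B, by simpa using hB⟩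

/-! ### Behaviour at the endpoint `1` -/

lemma exists_abs_potential_le (ha : 0 < a) (c χ : ℝ) :
    ∃ K > 0, ∀ x ∈ Ico (1 / 2 : ℝ) 1, |potential a c χ x| ≤ K := by
  refine ⟨4 * a + c ^ 2 + |χ|, by positivity, fun x hx => ?_⟩
  have hx0 : (0 : ℝ) < x := by linarith [hx.1]
  have h1 : a / x ^ 2 ≤ 4 * a := by
    rw [div_le_iff₀ (by positivity)]
    have : 1 / 4 ≤ x ^ 2 := by nlinarith [hx.1]
    nlinarith
  have h2 : 0 ≤ a / x ^ 2 := by positivity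
  have h3 : c ^ 2 * x ^ 2 ≤ c ^ 2 := mul_le_of_le_one_right (by positivity) (by nlinarith [hx.2])
  have h4 : 0 ≤ c ^ 2 * x ^ 2 := by positivity
  unfold potential
  rw [abs_le]
  constructor <;> linarith [le_abs_self χ, neg_abs_le χ, sq_nonneg c]

/-- A flux `g` above the barrier `K (1 - x)` stays away from `0`, so that `φ` diverges
logarithmically at `1`. -/
lemma snd_le_mul_one_sub (h : IsSolutionPair a c χ φ g) {M K : ℝ}
    (hM : ∀ x ∈ Ioo (0 : ℝ) 1, |φ x| ≤ M)
    (hK : ∀ x ∈ Ico (1 / 2 : ℝ) 1, |potential a c χ x * φ x| ≤ K) {x : ℝ}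
    (hx : x ∈ Ico (1 / 2 : ℝ) 1) : g x ≤ K * (1 - x) := by
  by_contra! hcon
  set δ := g x - K * (1 - x) with hδ
  have hδpos : 0 < δ := by linarith
  have hx1 := hx.2
  have hmem : ∀ t ∈ Ico x 1, t ∈ Ioo (0 : ℝ) 1 := fun t ht => ⟨by linarith [hx.1, ht.1], ht.2⟩
  have hK0 : 0 ≤ K := (abs_nonneg _).trans (hK x hx)
  have hg : ∀ y ∈ Ico x 1, δ ≤ g y := fun y hy => by
    have := le_of_hasDerivAt_nonneg (f := fun t => g t + K * t) hy.1
      (fun t ht => (h.hasDerivAt_snd t (hmem t ⟨ht.1, ht.2.trans_lt hy.2⟩)).add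
        ((hasDerivAt_id t).const_mul K)) (fun t ht => by
        have := (abs_le.1 (hK t ⟨hx.1.trans ht.1, ht.2.trans_lt hy.2⟩)).1
        linarith)
    have h2 : K * y ≤ K * 1 := mul_le_mul_of_nonneg_left hy.2.le hK0
    linarith
  have hlog : ∀ y ∈ Ico x 1, φ x + δ / 2 * Real.log (1 - x) ≤ φ y + δ / 2 * Real.log (1 - y) :=
    fun y hy => le_of_hasDerivAt_nonneg (f := fun t => φ t + δ / 2 * Real.log (1 - t)) hy.1
      (fun t ht => (h.hasDerivAt_fst t (hmem t ⟨ht.1, ht.2.trans_lt hy.2⟩)).add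
        ((((hasDerivAt_id t).const_sub 1).log
          (sub_pos.2 (ht.2.trans_lt hy.2)).ne').const_mul (δ / 2))) (fun t ht => by
        have ht' : t ∈ Ico x 1 := ⟨ht.1, ht.2.trans_lt hy.2⟩
        have hp := one_sub_sq_pos (hmem t ht')
        have ht1 : 0 < 1 - t := sub_pos.2 ht'.2
        have h1 : δ / 2 * (-1 / (1 - t)) = - (δ / 2 / (1 - t)) := by ring
        have h2 : δ / 2 / (1 - t) ≤ g t / (1 - t ^ 2) := by
          rw [div_le_div_iff₀ ht1 hp]
          have e : δ / 2 * (1 - t ^ 2) = (δ * ((1 + t) / 2)) * (1 - t) := by ring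
          rw [e]
          refine mul_le_mul_of_nonneg_right ?_ ht1.le
          have := hg t ht'
          nlinarith [ht'.2]
        simp only [id]
        rw [h1]
        linarith)
  have hM0 : 0 ≤ M := (abs_nonneg _).trans (hM x (hmem x ⟨le_rfl, hx1⟩))
  -- at `1 - y = (1 - x) exp (-R)` the logarithm exceeds the bound
  set R := (2 * M + 1) / (δ / 2) with hR
  have hRpos : 0 ≤ R := by positivity
  have hx1' : 0 < 1 - x := sub_pos.2 hx1
  have hy : 1 - (1 - x) * Real.exp (-R) ∈ Ico x 1 := by
    have h1 : (1 - x) * Real.exp (-R) ≤ 1 - x :=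
      mul_le_of_le_one_right hx1'.le (by simpa using hRpos)
    have h2 : 0 < (1 - x) * Real.exp (-R) := by positivity
    constructor <;> linarith
  have h1 := hlog _ hy
  rw [sub_sub_cancel, Real.log_mul hx1'.ne' (Real.exp_pos _).ne', Real.log_exp] at h1
  have h2 := (abs_le.1 (hM _ (hmem _ hy))).2
  have h3 := (abs_le.1 (hM x (hmem x ⟨le_rfl, hx1⟩))).1
  have h4 : δ / 2 * R = 2 * M + 1 := by rw [hR]; field_simp
  nlinarith

lemma tendsto_snd_one (h : IsSolutionPair a c χ φ g) (ha : 0 < a) {M : ℝ}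
    (hM : ∀ x ∈ Ioo (0 : ℝ) 1, |φ x| ≤ M) : Tendsto g (𝓝[<] 1) (𝓝 0) := by
  obtain ⟨K, hK0, hK⟩ := exists_abs_potential_le ha c χ
  have hmem : ∀ x ∈ Ico (1 / 2 : ℝ) 1, x ∈ Ioo (0 : ℝ) 1 := fun x hx => ⟨by linarith [hx.1], hx.2⟩
  have hKM : ∀ x ∈ Ico (1 / 2 : ℝ) 1, |potential a c χ x * φ x| ≤ K * M := fun x hx => by
    rw [abs_mul]
    exact mul_le_mul (hK x hx) (hM x (hmem x hx)) (abs_nonneg _) hK0.le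
  have hlim : Tendsto (fun x : ℝ => K * M * (1 - x)) (𝓝[<] 1) (𝓝 0) := by
    have : Tendsto (fun x : ℝ => K * M * (1 - x)) (𝓝 1) (𝓝 (K * M * (1 - 1))) :=
      (by fun_prop : Continuous fun x : ℝ => K * M * (1 - x)).tendsto 1
    simpa using this.mono_left nhdsWithin_le_nhds
  refine squeeze_zero_norm' ?_ hlim
  filter_upwards [Ioo_mem_nhdsLT (show (1 / 2 : ℝ) < 1 by norm_num)] with x hx
  have h1 := h.snd_le_mul_one_sub hM hKM ⟨hx.1.le, hx.2⟩
  have h2 := h.neg.snd_le_mul_one_sub (M := M) (K := K * M) (by simpa using hM)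
    (by simpa using hKM) ⟨hx.1.le, hx.2⟩
  rw [Real.norm_eq_abs, abs_le]
  constructor <;> linarith

/-! ### Zeros lie to the right of the turning point -/

lemma continuousOn_fst (h : IsSolutionPair a c χ φ g) : ContinuousOn φ (Ioo 0 1) :=
  fun x hx => (h.hasDerivAt_fst x hx).continuousAt.continuousWithinAt

/-- A solution with vanishing data at `z` vanishes to the right of `z`: Grönwall for `φ² + g²`. -/
lemma eq_zero_of_eq_zero (h : IsSolutionPair a c χ φ g) {z t : ℝ} (hz : 0 < z) (hzt : z ≤ t)
    (ht : t < 1) (hφ : φ z = 0) (hg : g z = 0) : φ t = 0 := by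
  have hmem : ∀ x ∈ Icc z t, x ∈ Ioo (0 : ℝ) 1 :=
    fun x hx => ⟨hz.trans_le hx.1, hx.2.trans_lt ht⟩
  have hcont : ContinuousOn (fun x => 1 / (1 - x ^ 2) + |potential a c χ x|) (Icc z t) := by
    refine ContinuousOn.add (ContinuousOn.div (by fun_prop) (by fun_prop)
      fun x hx => (one_sub_sq_pos (hmem x hx)).ne') (ContinuousOn.abs ?_)
    unfold potential
    refine ContinuousOn.sub (ContinuousOn.add (ContinuousOn.div (by fun_prop) (by fun_prop)
      fun x hx => ?_) (by fun_prop)) (by fun_prop)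
    have := (hmem x hx).1
    positivity
  obtain ⟨K, hK⟩ := isCompact_Icc.bddAbove_image hcont
  have hK' : ∀ x ∈ Icc z t, 1 / (1 - x ^ 2) + |potential a c χ x| ≤ K :=
    fun x hx => hK (mem_image_of_mem _ hx)
  have key := le_of_hasDerivAt_nonpos (f := fun x => Real.exp (-K * x) * (φ x ^ 2 + g x ^ 2)) hzt
    (fun x hx => (((hasDerivAt_id x).const_mul (-K)).exp).mul
      ((h.hasDerivAt_sq (hmem x hx)).add ((h.hasDerivAt_snd x (hmem x hx)).pow 2))) (fun x hx => by
      have hp := one_sub_sq_pos (hmem x hx)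
      have hb := hK' x hx
      set v := potential a c χ x
      set u := 1 / (1 - x ^ 2) with hu
      have hu0 : 0 < u := by positivity
      have h1 : 2 * (φ x * g x) / (1 - x ^ 2) = 2 * (φ x * g x) * u := by rw [hu]; ring
      have h2 : 2 * (φ x * g x) * (u + v) ≤ K * (φ x ^ 2 + g x ^ 2) := by
        have h3 : |2 * (φ x * g x) * (u + v)| ≤ (φ x ^ 2 + g x ^ 2) * K := by
          rw [abs_mul]
          refine mul_le_mul ?_ (((abs_add_le _ _).trans_eq (by rw [abs_of_pos hu0])).trans hb)
            (abs_nonneg _) (by positivity)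
          rw [abs_le]
          constructor <;> nlinarith [sq_nonneg (φ x + g x), sq_nonneg (φ x - g x)]
        linarith [le_abs_self (2 * (φ x * g x) * (u + v))]
      have he := Real.exp_pos (-K * x)
      rw [h1]
      simp only [id, Pi.add_apply, Pi.pow_apply, Nat.cast_ofNat, Nat.add_one_sub_one, pow_one,
        mul_one]
      nlinarith [mul_le_mul_of_nonneg_left h2 he.le])
  have he := Real.exp_pos (-K * t)
  have h0 : φ t ^ 2 + g t ^ 2 ≤ 0 := by
    by_contra! hc
    have := mul_pos he hc
    rw [hφ, hg, zero_pow two_ne_zero, add_zero, mul_zero] at key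
    linarith
  nlinarith [sq_nonneg (φ t), sq_nonneg (g t)]

/-- On `(0, z)` with `z² < a / χ` the potential is positive, so `φ g` increases from its limit `0`
at the origin and `φ` cannot return to zero. -/
lemma le_mul_sq_of_eq_zero (h : IsSolutionPair a c χ φ g) (ha : 0 < a) {M : ℝ}
    (hM : ∀ x ∈ Ioo (0 : ℝ) 1, |φ x| ≤ M) (hne : ∃ x ∈ Ioo (0 : ℝ) 1, φ x ≠ 0) {z : ℝ}
    (hz : z ∈ Ioo (0 : ℝ) 1) (hφz : φ z = 0) : a ≤ χ * z ^ 2 := by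
  by_contra! hcon
  have hmem : ∀ x ∈ Ioc 0 z, x ∈ Ioo (0 : ℝ) 1 := fun x hx => ⟨hx.1, hx.2.trans_lt hz.2⟩
  have hV : ∀ x ∈ Ioc 0 z, 0 < potential a c χ x := fun x hx => by
    have hx0 := hx.1
    have h1 : χ < a / x ^ 2 := by
      rw [lt_div_iff₀ (by positivity)]
      rcases le_total χ 0 with h0 | h0
      · nlinarith [sq_nonneg x]
      · exact lt_of_le_of_lt (mul_le_mul_of_nonneg_left (by nlinarith [hx.2]) h0) hcon
    have h2 : 0 ≤ c ^ 2 * x ^ 2 := by positivity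
    unfold potential
    linarith
  have hmono : ∀ x ∈ Ioc 0 z, ∀ y ∈ Ioc 0 x, φ y * g y ≤ φ x * g x := fun x hx y hy =>
    le_of_hasDerivAt_nonneg (f := fun t => φ t * g t) hy.2
      (fun t ht => h.hasDerivAt_mul (hmem t ⟨hy.1.trans_le ht.1, ht.2.trans hx.2⟩))
      (fun t ht => by
        have ht' : t ∈ Ioc 0 z := ⟨hy.1.trans_le ht.1, ht.2.trans hx.2⟩
        have hp := one_sub_sq_pos (hmem t ht')
        have := hV t ht'
        positivity)
  have hlim := h.tendsto_mul_zero ha hM (h.tendsto_zero_and_bounded ha hM).1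
  have hzero : ∀ x ∈ Ioc 0 z, φ x * g x = 0 := fun x hx => by
    refine le_antisymm ?_ (le_of_tendsto hlim ?_)
    · simpa [hφz] using hmono z ⟨hz.1, le_rfl⟩ x hx
    · filter_upwards [Ioo_mem_nhdsGT hx.1] with y hy using hmono x hx y ⟨hy.1, hy.2.le⟩
  obtain ⟨t, ht, hφt⟩ := hne
  obtain ⟨x, hx0, hx⟩ := exists_between (lt_min ht.1 hz.1)
  have hxt : x < t := hx.trans_le (min_le_left _ _)
  have hxz : x < z := hx.trans_le (min_le_right _ _)
  have hd := h.hasDerivAt_mul (hmem x ⟨hx0, hxz.le⟩)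
  have hd0 : HasDerivAt (fun t => φ t * g t) 0 x := by
    refine (hasDerivAt_const x (0 : ℝ)).congr_of_eventuallyEq ?_
    filter_upwards [Ioo_mem_nhds hx0 hxz] with y hy using hzero y ⟨hy.1, hy.2.le⟩
  have heq := hd.unique hd0
  have hp := one_sub_sq_pos (hmem x ⟨hx0, hxz.le⟩)
  have hVx := hV x ⟨hx0, hxz.le⟩
  have h1 : 0 ≤ g x ^ 2 / (1 - x ^ 2) := by positivity
  have h2 : 0 ≤ potential a c χ x * φ x ^ 2 := by positivity
  have h3 : g x ^ 2 / (1 - x ^ 2) = 0 := by linarith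
  have h4 : potential a c χ x * φ x ^ 2 = 0 := by linarith
  have hgx : g x = 0 := by simpa [hp.ne'] using h3
  have hφx : φ x = 0 := by simpa [hVx.ne'] using h4
  exact hφt (h.eq_zero_of_eq_zero hx0 hxt.le ht.2 hφx hgx)

end IsSolutionPair

/-! ### Sturm comparison of two eigenfunctions -/

lemma exists_zero_pos_before {f : ℝ → ℝ} {p z : ℝ} (hpz : p ≤ z) (hc : ContinuousOn f (Icc p z))
    (hp : 0 < f p) (hz : f z ≤ 0) : ∃ q ∈ Icc p z, f q = 0 ∧ ∀ t ∈ Ico p q, 0 < f t := by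
  obtain ⟨w, hw, hw0⟩ := intermediate_value_Icc' hpz hc ⟨hz, hp.le⟩
  have hS : IsCompact (Icc p z ∩ f ⁻¹' {0}) :=
    isCompact_Icc.of_isClosed_subset
      (hc.preimage_isClosed_of_isClosed isClosed_Icc isClosed_singleton) inter_subset_left
  obtain ⟨q, hq, hleast⟩ := hS.exists_isLeast ⟨w, hw, hw0⟩
  refine ⟨q, hq.1, hq.2, fun t ht => ?_⟩
  by_contra! hneg
  have htz : t ≤ z := ht.2.le.trans hq.1.2
  obtain ⟨r, hr, hr0⟩ := intermediate_value_Icc' ht.1 (hc.mono (Icc_subset_Icc_right htz))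
    ⟨hneg, hp.le⟩
  exact absurd (hleast ⟨⟨hr.1, hr.2.trans htz⟩, hr0⟩) (not_le.2 (hr.2.trans_lt ht.2))

lemma exists_zero_pos_after {f : ℝ → ℝ} {z p : ℝ} (hzp : z ≤ p) (hc : ContinuousOn f (Icc z p))
    (hp : 0 < f p) (hz : f z ≤ 0) : ∃ q ∈ Icc z p, f q = 0 ∧ ∀ t ∈ Ioc q p, 0 < f t := by
  obtain ⟨q, hq, hq0, hpos⟩ := exists_zero_pos_before (f := fun t => f (-t)) (p := -p) (z := -z)
    (by linarith) (hc.comp continuous_neg.continuousOn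
      fun x hx => ⟨by linarith [hx.2], by linarith [hx.1]⟩) (by simpa) (by simpa)
  refine ⟨-q, ⟨by linarith [hq.2], by linarith [hq.1]⟩, hq0, fun t ht => ?_⟩
  simpa using hpos (-t) ⟨by linarith [ht.2], by linarith [ht.1]⟩

namespace IsSolutionPair

variable {a c χ χ' : ℝ} {φ g ψ k : ℝ → ℝ}

lemma hasDerivAt_wronskian (h : IsSolutionPair a c χ φ g) (h' : IsSolutionPair a c χ' ψ k) {x : ℝ}
    (hx : x ∈ Ioo (0 : ℝ) 1) :
    HasDerivAt (fun t => ψ t * g t - φ t * k t) (-((χ - χ') * (φ x * ψ x))) x :=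
  (((h'.hasDerivAt_fst x hx).mul (h.hasDerivAt_snd x hx)).sub
    ((h.hasDerivAt_fst x hx).mul (h'.hasDerivAt_snd x hx))).congr_deriv (by
      unfold potential; ring)

lemma hasDerivAt_ratio (h : IsSolutionPair a c χ φ g) (h' : IsSolutionPair a c χ' ψ k) {x : ℝ}
    (hx : x ∈ Ioo (0 : ℝ) 1) (hφ : φ x ≠ 0) :
    HasDerivAt (fun t => ψ t / φ t) (-(ψ x * g x - φ x * k x) / ((1 - x ^ 2) * φ x ^ 2)) x :=
  ((h'.hasDerivAt_fst x hx).div (h.hasDerivAt_fst x hx) hφ).congr_deriv (by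
    have := (one_sub_sq_pos hx).ne'
    field_simp
    ring)

/-- Where `ψ > 0`, the Wronskian of a positive solution `φ` and a solution `ψ` of smaller eigenvalue
is strictly decreasing. At a point `t₀` with `ψ > 0` it is either nonpositive, whence `ψ / φ`
increases and `ψ` stays positive up to `1`, or nonnegative, whence `ψ` is positive down to `0`.
Either way this contradicts that the Wronskian vanishes at both ends. -/
lemma false_of_pos (h : IsSolutionPair a c χ φ g) (h' : IsSolutionPair a c χ' ψ k) (ha : 0 < a)
    (hχ : χ' < χ) {M M' : ℝ} (hM : ∀ x ∈ Ioo (0 : ℝ) 1, |φ x| ≤ M)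
    (hM' : ∀ x ∈ Ioo (0 : ℝ) 1, |ψ x| ≤ M') (hφ : ∀ x ∈ Ioo (0 : ℝ) 1, 0 < φ x) {t₀ : ℝ}
    (ht₀ : t₀ ∈ Ioo (0 : ℝ) 1) (hψ : 0 < ψ t₀) : False := by
  set W : ℝ → ℝ := fun t => ψ t * g t - φ t * k t with hW
  have hdW : ∀ x ∈ Ioo (0 : ℝ) 1, HasDerivAt W (-((χ - χ') * (φ x * ψ x))) x :=
    fun x hx => h.hasDerivAt_wronskian h' hx
  have hneg : ∀ x ∈ Ioo (0 : ℝ) 1, 0 < ψ x → -((χ - χ') * (φ x * ψ x)) < 0 := fun x hx hpos =>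
    neg_neg_of_pos (mul_pos (sub_pos.2 hχ) (mul_pos (hφ x hx) hpos))
  have hlim0 : Tendsto W (𝓝[>] 0) (𝓝 0) := by
    simpa using (h.tendsto_mul_zero ha hM (h'.tendsto_zero_and_bounded ha hM').1).sub
      (h'.tendsto_mul_zero ha hM' (h.tendsto_zero_and_bounded ha hM).1)
  have hbdd : ∀ {f : ℝ → ℝ} {C : ℝ}, (∀ x ∈ Ioo (0 : ℝ) 1, |f x| ≤ C) →
      IsBoundedUnder (· ≤ ·) (𝓝[<] (1 : ℝ)) (norm ∘ f) := fun {f C} hf => by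
    refine ⟨C, ?_⟩
    rw [eventually_map]
    filter_upwards [Ioo_mem_nhdsLT (show (0 : ℝ) < 1 by norm_num)] with x hx using hf x hx
  have hlim1 : Tendsto W (𝓝[<] 1) (𝓝 0) := by
    simpa using (isBoundedUnder_le_mul_tendsto_zero (hbdd hM') (h.tendsto_snd_one ha hM)).sub
      (isBoundedUnder_le_mul_tendsto_zero (hbdd hM) (h'.tendsto_snd_one ha hM'))
  rcases le_total (W t₀) 0 with hle | hge
  · have hmem : ∀ x ∈ Ico t₀ 1, x ∈ Ioo (0 : ℝ) 1 := fun x hx => ⟨ht₀.1.trans_le hx.1, hx.2⟩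
    have hpos : ∀ z ∈ Ico t₀ 1, 0 < ψ z := by
      intro z hz
      by_contra! hψz
      obtain ⟨q, hq, hq0, hlt⟩ := exists_zero_pos_before hz.1
        (h'.continuousOn_fst.mono fun x hx => hmem x ⟨hx.1, hx.2.trans_lt hz.2⟩) hψ hψz
      have hmem' : ∀ x ∈ Icc t₀ q, x ∈ Ioo (0 : ℝ) 1 := fun x hx =>
        hmem x ⟨hx.1, (hx.2.trans hq.2).trans_lt hz.2⟩
      have hnn : ∀ x ∈ Icc t₀ q, 0 ≤ ψ x := fun x hx =>
        hx.2.lt_or_eq.elim (fun hxq => (hlt x ⟨hx.1, hxq⟩).le) (fun hxq => by rw [hxq, hq0])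
      have hWneg : ∀ x ∈ Icc t₀ q, W x ≤ 0 := fun x hx =>
        (le_of_hasDerivAt_nonpos hx.1 (fun t ht => hdW t (hmem' t ⟨ht.1, ht.2.trans hx.2⟩))
          (fun t ht => neg_nonpos.2 (mul_nonneg (sub_pos.2 hχ).le
            (mul_nonneg (hφ t (hmem' t ⟨ht.1, ht.2.trans hx.2⟩)).le
              (hnn t ⟨ht.1, ht.2.trans hx.2⟩))))).trans hle
      have := le_of_hasDerivAt_nonneg hq.1
        (fun t ht => h.hasDerivAt_ratio h' (hmem' t ht) (hφ t (hmem' t ht)).ne')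
        (fun t ht => div_nonneg (neg_nonneg.2 (hWneg t ht))
          (mul_nonneg (one_sub_sq_pos (hmem' t ht)).le (sq_nonneg _)))
      rw [hq0, zero_div] at this
      exact absurd this (not_le.2 (div_pos hψ (hφ t₀ ht₀)))
    obtain ⟨t₁, ht₁, ht₁'⟩ := exists_between ht₀.2
    have h1 : W t₁ < W t₀ := lt_of_hasDerivAt_neg ht₁
      (fun t ht => hdW t (hmem t ⟨ht.1, ht.2.trans_lt ht₁'⟩))
      (fun t ht => hneg t (hmem t ⟨ht.1, ht.2.trans_lt ht₁'⟩)
        (hpos t ⟨ht.1, ht.2.trans_lt ht₁'⟩))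
    have h2 : 0 ≤ W t₁ := le_of_tendsto hlim1 (by
      filter_upwards [Ioo_mem_nhdsLT ht₁'] with y hy
      have hsub : ∀ t ∈ Icc t₁ y, t ∈ Ico t₀ 1 :=
        fun t ht => ⟨ht₁.le.trans ht.1, ht.2.trans_lt hy.2⟩
      exact le_of_hasDerivAt_nonpos hy.1.le (fun t ht => hdW t (hmem t (hsub t ht)))
        (fun t ht => (hneg t (hmem t (hsub t ht)) (hpos t (hsub t ht))).le))
    linarith
  · have hmem : ∀ x ∈ Ioc 0 t₀, x ∈ Ioo (0 : ℝ) 1 := fun x hx => ⟨hx.1, hx.2.trans_lt ht₀.2⟩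
    have hpos : ∀ z ∈ Ioc 0 t₀, 0 < ψ z := by
      intro z hz
      by_contra! hψz
      obtain ⟨q, hq, hq0, hlt⟩ := exists_zero_pos_after hz.2
        (h'.continuousOn_fst.mono fun x hx => hmem x ⟨hz.1.trans_le hx.1, hx.2⟩) hψ hψz
      have hmem' : ∀ x ∈ Icc q t₀, x ∈ Ioo (0 : ℝ) 1 := fun x hx =>
        hmem x ⟨(hz.1.trans_le hq.1).trans_le hx.1, hx.2⟩
      have hnn : ∀ x ∈ Icc q t₀, 0 ≤ ψ x := fun x hx =>
        hx.1.lt_or_eq.elim (fun hxq => (hlt x ⟨hxq, hx.2⟩).le) (fun hxq => by rw [← hxq, hq0])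
      have hWpos : ∀ x ∈ Icc q t₀, 0 ≤ W x := fun x hx =>
        hge.trans (le_of_hasDerivAt_nonpos hx.2
          (fun t ht => hdW t (hmem' t ⟨hx.1.trans ht.1, ht.2⟩))
          (fun t ht => neg_nonpos.2 (mul_nonneg (sub_pos.2 hχ).le
            (mul_nonneg (hφ t (hmem' t ⟨hx.1.trans ht.1, ht.2⟩)).le
              (hnn t ⟨hx.1.trans ht.1, ht.2⟩)))))
      have := le_of_hasDerivAt_nonpos hq.2
        (fun t ht => h.hasDerivAt_ratio h' (hmem' t ht) (hφ t (hmem' t ht)).ne')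
        (fun t ht => div_nonpos_of_nonpos_of_nonneg (neg_nonpos.2 (hWpos t ht))
          (mul_nonneg (one_sub_sq_pos (hmem' t ht)).le (sq_nonneg _)))
      rw [hq0, zero_div] at this
      exact absurd this (not_le.2 (div_pos hψ (hφ t₀ ht₀)))
    obtain ⟨t₁, ht₁', ht₁⟩ := exists_between ht₀.1
    have h1 : W t₀ < W t₁ := lt_of_hasDerivAt_neg ht₁
      (fun t ht => hdW t (hmem t ⟨ht₁'.trans_le ht.1, ht.2⟩))
      (fun t ht => hneg t (hmem t ⟨ht₁'.trans_le ht.1, ht.2⟩)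
        (hpos t ⟨ht₁'.trans_le ht.1, ht.2⟩))
    have h2 : W t₁ ≤ 0 := ge_of_tendsto hlim0 (by
      filter_upwards [Ioo_mem_nhdsGT ht₁'] with y hy
      have hsub : ∀ t ∈ Icc y t₁, t ∈ Ioc 0 t₀ :=
        fun t ht => ⟨hy.1.trans_le ht.1, ht.2.trans ht₁.le⟩
      exact le_of_hasDerivAt_nonpos hy.2.le (fun t ht => hdW t (hmem t (hsub t ht)))
        (fun t ht => (hneg t (hmem t (hsub t ht)) (hpos t (hsub t ht))).le))
    linarith

lemma exists_zero (h : IsSolutionPair a c χ φ g) (h' : IsSolutionPair a c χ' ψ k) (ha : 0 < a)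
    (hχ : χ' < χ) {M M' : ℝ} (hM : ∀ x ∈ Ioo (0 : ℝ) 1, |φ x| ≤ M)
    (hM' : ∀ x ∈ Ioo (0 : ℝ) 1, |ψ x| ≤ M') (hψ : ∃ x ∈ Ioo (0 : ℝ) 1, ψ x ≠ 0) :
    ∃ x ∈ Ioo (0 : ℝ) 1, φ x = 0 := by
  by_contra! hne
  obtain ⟨t, ht, hψt⟩ := hψ
  have main : ∀ {f k : ℝ → ℝ} {t : ℝ}, IsSolutionPair a c χ f k →
      (∀ x ∈ Ioo (0 : ℝ) 1, |f x| ≤ M) → (∀ x ∈ Ioo (0 : ℝ) 1, 0 < f x) → False := by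
    intro f k t hf hfM hpos
    rcases lt_or_gt_of_ne hψt with hlt | hgt
    · exact hf.false_of_pos h'.neg ha hχ hfM (by simpa using hM') hpos ht (by simpa using hlt)
    · exact hf.false_of_pos h' ha hχ hfM hM' hpos ht hgt
  have hsign : (∀ x ∈ Ioo (0 : ℝ) 1, 0 < φ x) ∨ (∀ x ∈ Ioo (0 : ℝ) 1, φ x < 0) := by
    by_contra! hcon
    obtain ⟨⟨x, hx, hxn⟩, ⟨y, hy, hyp⟩⟩ := hcon
    obtain ⟨z, hz, hz0⟩ := isPreconnected_Ioo.intermediate_value hx hy h.continuousOn_fst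
      ⟨hxn, hyp⟩
    exact hne z hz hz0
  rcases hsign with hpos | hneg
  · exact main (t := t) h hM hpos
  · exact main (t := t) h.neg (by simpa using hM) (by simpa using hneg)

end IsSolutionPair

/-! ### A Rayleigh quotient for the radial Bessel problem -/

/-- For the trial function `p(y) = (1 - y)(1 - y/2)`, the polynomial
`y^(-α-1) ∫₀^y η^α (4 η p'(η)² - J² p(η)²) dη`. At `y = 1` and in the variable
`t = √η` this is twice the difference of the energy of `p(t²)` and `J²` times its squared norm, both
on `(0, 1)` with weight `t^(2α+1)`. -/
noncomputable def trialEnergy (α J y : ℝ) : ℝ :=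
  -J ^ 2 / (α + 1) + (9 + 3 * J ^ 2) / (α + 2) * y - (12 + 13 / 4 * J ^ 2) / (α + 3) * y ^ 2
    + (4 + 3 / 2 * J ^ 2) / (α + 4) * y ^ 3 - J ^ 2 / 4 / (α + 5) * y ^ 4

/-- The Rayleigh quotient of the trial function is below `(π + (π/2) α - 3/4)²`. In particular the
first zero of the Bessel function of order `α` is below `π + (π/2) α - 3/4`. -/
lemma trialEnergy_one_neg {α : ℝ} (hα : 1 / 2 < α) :
    trialEnergy α (Real.pi + Real.pi / 2 * α - 3 / 4) 1 < 0 := by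
  set J := Real.pi + Real.pi / 2 * α - 3 / 4 with hJ
  have hpi := Real.pi_gt_d2
  -- in `t = α - 1/2`, after `π > 3.14`, the inequality is between polynomials and all coefficients
  -- of the difference are positive
  obtain ⟨t, ht, rfl⟩ : ∃ t, 0 < t ∧ α = t + 1 / 2 := ⟨α - 1 / 2, by linarith, by ring⟩
  have hJ1 : 157 / 50 * (5 / 4) - 3 / 4 + 157 / 100 * t ≤ J := by
    rw [hJ]
    nlinarith
  have hJ2 : (157 / 50 * (5 / 4) - 3 / 4 + 157 / 100 * t) ^ 2 ≤ J ^ 2 :=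
    pow_le_pow_left₀ (by linarith) hJ1 2
  have e : trialEnergy (t + 1 / 2) J 1 =
      ((t ^ 4 + 19 * t ^ 3 + 134 * t ^ 2 + 1565 / 4 * t + 5511 / 16)
        - J ^ 2 * (t ^ 2 / 2 + 8 * t + 279 / 8)) /
      ((t + 3 / 2) * (t + 5 / 2) * (t + 7 / 2) * (t + 9 / 2) * (t + 11 / 2)) := by
    unfold trialEnergy
    rw [show t + 1 / 2 + 1 = t + 3 / 2 by ring, show t + 1 / 2 + 2 = t + 5 / 2 by ring,
      show t + 1 / 2 + 3 = t + 7 / 2 by ring, show t + 1 / 2 + 4 = t + 9 / 2 by ring,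
      show t + 1 / 2 + 5 = t + 11 / 2 by ring]
    field_simp
    ring
  rw [e]
  refine div_neg_of_neg_of_pos ?_ (by positivity)
  have h1 := mul_le_mul_of_nonneg_right hJ2
    (show 0 ≤ t ^ 2 / 2 + 8 * t + 279 / 8 by positivity)
  have h2 : 0 < (157 / 50 * (5 / 4) - 3 / 4 + 157 / 100 * t) ^ 2 * (t ^ 2 / 2 + 8 * t + 279 / 8)
      - (t ^ 4 + 19 * t ^ 3 + 134 * t ^ 2 + 1565 / 4 * t + 5511 / 16) := by
    ring_nf
    positivity
  linarith

/-- For the rescaled trial function `P(x) = (1 - τ x²)(1 - τ x²/2)`, a primitive of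
`x^(2α+1) (P'(x)² - J² τ P(x)²)`. -/
lemma hasDerivAt_trialEnergy {α J τ : ℝ} (hα : 1 / 2 < α) {x : ℝ} (hx : 0 < x) :
    HasDerivAt (fun t => τ / 2 * t ^ (2 * α + 2) * trialEnergy α J (τ * t ^ 2))
      (x ^ (2 * α + 1) * ((τ * x * (-3 + 2 * (τ * x ^ 2))) ^ 2 -
        J ^ 2 * τ * ((1 - τ * x ^ 2) * (1 - τ * x ^ 2 / 2)) ^ 2)) x := by
  have hy : HasDerivAt (fun t : ℝ => τ * t ^ 2) (τ * (2 * x)) x := by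
    simpa using ((hasDerivAt_id x).pow 2).const_mul τ
  have hE := ((((hy.const_mul ((9 + 3 * J ^ 2) / (α + 2))).const_add (-J ^ 2 / (α + 1))).sub
    ((hy.pow 2).const_mul ((12 + 13 / 4 * J ^ 2) / (α + 3)))).add
    ((hy.pow 3).const_mul ((4 + 3 / 2 * J ^ 2) / (α + 4)))).sub
    ((hy.pow 4).const_mul (J ^ 2 / 4 / (α + 5)))
  have hr : HasDerivAt (fun t : ℝ => t ^ (2 * α + 2)) ((2 * α + 2) * x ^ (2 * α + 1)) x := by
    have := Real.hasDerivAt_rpow_const (p := 2 * α + 2) (Or.inl hx.ne')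
    rwa [show 2 * α + 2 - 1 = 2 * α + 1 by ring] at this
  refine ((hr.const_mul (τ / 2)).mul hE).congr_deriv ?_
  have hs : x ^ (2 * α + 2) = x ^ (2 * α + 1) * x := by
    rw [show 2 * α + 2 = 2 * α + 1 + 1 by ring, Real.rpow_add_one hx.ne']
  simp only [hs, Pi.pow_apply, Pi.add_apply, Pi.sub_apply]
  have h1 : α + 1 ≠ 0 := by linarith
  have h2 : α + 2 ≠ 0 := by linarith
  have h3 : α + 3 ≠ 0 := by linarith
  have h4 : α + 4 ≠ 0 := by linarith
  have h5 : α + 5 ≠ 0 := by linarith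
  generalize x ^ (2 * α + 1) = r
  field_simp
  ring

/-! ### The Riccati equation and the upper bound -/

/-- With `φ = x^(α + 1/2) (1 - x²)^(-1/2) v`, this is the logarithmic derivative `v' / v`. -/
noncomputable def logDerivative (α : ℝ) (φ g : ℝ → ℝ) (x : ℝ) : ℝ :=
  g x / ((1 - x ^ 2) * φ x) - x / (1 - x ^ 2) - (α + 1 / 2) / x

namespace IsSolutionPair

variable {α c χ : ℝ} {φ g : ℝ → ℝ}

lemma hasDerivAt_logDerivative (h : IsSolutionPair (α ^ 2 - 1 / 4) c χ φ g) {x : ℝ}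
    (hx : x ∈ Ioo (0 : ℝ) 1) (hφ : φ x ≠ 0) :
    HasDerivAt (logDerivative α φ g)
      (-logDerivative α φ g x ^ 2 - (2 * α + 1) / x * logDerivative α φ g x
        - ((χ - c ^ 2 * x ^ 2 - (α ^ 2 - 1 / 4)) / (1 - x ^ 2) + 1 / (1 - x ^ 2) ^ 2)) x := by
  have hp := (one_sub_sq_pos hx).ne'
  have hx0 := hx.1.ne'
  have hp' : HasDerivAt (fun t : ℝ => 1 - t ^ 2) (-(2 * x)) x := by
    simpa using ((hasDerivAt_id x).pow 2).const_sub 1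
  refine ((((h.hasDerivAt_snd x hx).div (hp'.mul (h.hasDerivAt_fst x hx))
    (mul_ne_zero hp hφ)).sub ((hasDerivAt_id x).div hp' hp)).sub
    ((hasDerivAt_inv hx0).const_mul (α + 1 / 2))).congr_deriv ?_
  simp only [logDerivative, potential, id, Pi.mul_apply]
  field_simp
  ring

/-- The zeroth order coefficient of the Riccati equation is at least the constant `χ - a` of the
Bessel equation. -/
lemma sub_le_riccati_coefficient {x : ℝ} (hx : x ∈ Ioo (0 : ℝ) 1) {a : ℝ} (hχ : c ^ 2 + a ≤ χ) :
    χ - a ≤ (χ - c ^ 2 * x ^ 2 - a) / (1 - x ^ 2) + 1 / (1 - x ^ 2) ^ 2 := by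
  have hp := one_sub_sq_pos hx
  have h1 : χ - a ≤ (χ - c ^ 2 * x ^ 2 - a) / (1 - x ^ 2) := by
    rw [le_div_iff₀ hp]
    nlinarith [sq_nonneg x]
  have h2 : 0 ≤ 1 / (1 - x ^ 2) ^ 2 := by positivity
  linarith

/-- The quantity `N = x^(2α+1) v'/v` satisfies `N' ≤ -x^(-2α-1) N²`; a positive value would blow up
when continued towards `0`. -/
lemma logDerivative_nonpos (h : IsSolutionPair (α ^ 2 - 1 / 4) c χ φ g) (hα : 1 / 2 < α)
    (hχ : c ^ 2 + (α ^ 2 - 1 / 4) ≤ χ) {X : ℝ} (hX : X < 1) (hφ : ∀ x ∈ Ioc 0 X, φ x ≠ 0) {x : ℝ}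
    (hx : x ∈ Ioc 0 X) : logDerivative α φ g x ≤ 0 := by
  have hmem : ∀ t ∈ Ioc 0 x, t ∈ Ioo (0 : ℝ) 1 := fun t ht => ⟨ht.1, by linarith [ht.2, hx.2]⟩
  set v := logDerivative α φ g with hv
  set N : ℝ → ℝ := fun t => t ^ (2 * α + 1) * v t with hN
  set Q : ℝ → ℝ := fun t => (χ - c ^ 2 * t ^ 2 - (α ^ 2 - 1 / 4)) / (1 - t ^ 2)
    + 1 / (1 - t ^ 2) ^ 2 with hQ
  have hQ0 : ∀ t ∈ Ioc 0 x, 0 ≤ Q t := fun t ht => by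
    have := sub_le_riccati_coefficient (hmem t ht) hχ
    have h2 := sq_nonneg c
    simp only [hQ]
    linarith
  have hdN : ∀ t ∈ Ioc 0 x, HasDerivAt N (-(t ^ (2 * α + 1) * (v t ^ 2 + Q t))) t := by
    intro t ht
    have h1 := Real.hasDerivAt_rpow_const (p := 2 * α + 1) (Or.inl ht.1.ne')
    have h2 := h.hasDerivAt_logDerivative (hmem t ht) (hφ t ⟨ht.1, ht.2.trans hx.2⟩)
    refine (h1.mul h2).congr_deriv ?_
    rw [Real.rpow_sub_one ht.1.ne']
    simp only [hQ, ← hv]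
    ring
  by_contra! hpos
  have hx0 := hx.1
  have hNx : 0 < N x := mul_pos (Real.rpow_pos_of_pos hx.1 _) hpos
  have hNpos : ∀ t ∈ Ioc 0 x, 0 < N t := fun t ht =>
    hNx.trans_le (le_of_hasDerivAt_nonpos ht.2
      (fun u hu => hdN u ⟨ht.1.trans_le hu.1, hu.2⟩) (fun u hu => by
        have hu0 := ht.1.trans_le hu.1
        have := hQ0 u ⟨hu0, hu.2⟩
        have : 0 ≤ u ^ (2 * α + 1) * (v u ^ 2 + Q u) := by positivity
        linarith))
  -- since `t^(2α+1) ≤ t`, the derivative of `1 / N` is at least `1 / t`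
  have hlog : ∀ t ∈ Ioc 0 x, (N t)⁻¹ - Real.log t ≤ (N x)⁻¹ - Real.log x := fun t ht =>
    le_of_hasDerivAt_nonneg (f := fun u => (N u)⁻¹ - Real.log u) ht.2
      (fun u hu => ((hdN u ⟨ht.1.trans_le hu.1, hu.2⟩).inv
        (hNpos u ⟨ht.1.trans_le hu.1, hu.2⟩).ne').sub
        (Real.hasDerivAt_log (ht.1.trans_le hu.1).ne')) (fun u hu => by
        have hu' : u ∈ Ioc 0 x := ⟨ht.1.trans_le hu.1, hu.2⟩
        have hu0 := hu'.1
        have hr0 : 0 < u ^ (2 * α + 1) := Real.rpow_pos_of_pos hu0 _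
        have hr : u ^ (2 * α + 1) ≤ u := by
          simpa using Real.rpow_le_rpow_of_exponent_ge hu0 (hmem u hu').2.le
            (show (1 : ℝ) ≤ 2 * α + 1 by linarith)
        have hvu : v u ≠ 0 := by
          intro h0
          have := hNpos u hu'
          simp [hN, h0] at this
        have hv2 : 0 < v u ^ 2 := by positivity
        rw [neg_neg, sub_nonneg, le_div_iff₀ (pow_pos (hNpos u hu') 2)]
        simp only [hN]
        have h1 : u⁻¹ * (u ^ (2 * α + 1) * v u) ^ 2 =
            (u⁻¹ * u ^ (2 * α + 1)) * (u ^ (2 * α + 1) * v u ^ 2) := by ring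
        have h2 : u⁻¹ * u ^ (2 * α + 1) ≤ 1 := by
          rw [inv_mul_le_iff₀ hu0]
          simpa using hr
        rw [h1]
        calc (u⁻¹ * u ^ (2 * α + 1)) * (u ^ (2 * α + 1) * v u ^ 2)
            ≤ 1 * (u ^ (2 * α + 1) * v u ^ 2) :=
              mul_le_mul_of_nonneg_right h2 (by positivity)
          _ ≤ u ^ (2 * α + 1) * (v u ^ 2 + Q u) := by
              nlinarith [mul_nonneg hr0.le (hQ0 u hu')])
  have hmem' : x * Real.exp (-(N x)⁻¹) ∈ Ioc 0 x :=
    ⟨by positivity, mul_le_of_le_one_right hx0.le (by simpa using hNx.le)⟩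
  have h1 := hlog _ hmem'
  rw [Real.log_mul hx0.ne' (Real.exp_pos _).ne', Real.log_exp] at h1
  have h2 := inv_pos.2 (hNpos _ hmem')
  linarith

/-- Picone's argument: if `φ` had no zero up to `X = J / √(χ - a)`, `a = α² - 1/4`, then the energy
of every trial function on `(0, X)` would be at least `χ - a` times its norm. -/
lemma exists_zero_le (h : IsSolutionPair (α ^ 2 - 1 / 4) c χ φ g) (hα : 1 / 2 < α)
    (hχ : c ^ 2 + (α ^ 2 - 1 / 4) ≤ χ) {X J : ℝ} (hX0 : 0 < X) (hX : X < 1)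
    (hJ : J ^ 2 = (χ - (α ^ 2 - 1 / 4)) * X ^ 2) (hneg : trialEnergy α J 1 < 0) :
    ∃ x ∈ Ioc 0 X, φ x = 0 := by
  by_contra! hφ
  have hmem : ∀ t ∈ Ioc 0 X, t ∈ Ioo (0 : ℝ) 1 := fun t ht => ⟨ht.1, ht.2.trans_lt hX⟩
  set τ := (X ^ 2)⁻¹ with hτ
  have hτ0 : 0 < τ := by positivity
  have hτX : τ * X ^ 2 = 1 := inv_mul_cancel₀ (by positivity)
  set P : ℝ → ℝ := fun t => (1 - τ * t ^ 2) * (1 - τ * t ^ 2 / 2) with hP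
  set v := logDerivative α φ g with hv
  set F : ℝ → ℝ := fun t => τ / 2 * t ^ (2 * α + 2) * trialEnergy α J (τ * t ^ 2) with hF
  set G : ℝ → ℝ := fun t => t ^ (2 * α + 1) * P t ^ 2 * v t - F t with hG
  have hP' : ∀ t, HasDerivAt P (τ * t * (-3 + 2 * (τ * t ^ 2))) t := fun t => by
    have hy : HasDerivAt (fun t : ℝ => τ * t ^ 2) (τ * (2 * t)) t := by
      simpa using ((hasDerivAt_id t).pow 2).const_mul τ
    exact ((hy.const_sub 1).mul ((hy.div_const 2).const_sub 1)).congr_deriv (by ring)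
  have hanti : ∀ y ∈ Ioc 0 X, G X ≤ G y := fun y hy =>
    le_of_hasDerivAt_nonpos (f := G) hy.2 (fun t ht => by
      have ht' : t ∈ Ioc 0 X := ⟨hy.1.trans_le ht.1, ht.2⟩
      have h1 := Real.hasDerivAt_rpow_const (p := 2 * α + 1) (Or.inl ht'.1.ne')
      exact ((h1.mul ((hP' t).pow 2)).mul
        (h.hasDerivAt_logDerivative (hmem t ht') (hφ t ht'))).sub
        (hasDerivAt_trialEnergy (J := J) (τ := τ) hα ht'.1)) (fun t ht => by
      have ht' : t ∈ Ioc 0 X := ⟨hy.1.trans_le ht.1, ht.2⟩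
      have hQ := sub_le_riccati_coefficient (hmem t ht') hχ
      have hr : 0 < t ^ (2 * α + 1) := Real.rpow_pos_of_pos ht'.1 _
      have hJτ : J ^ 2 * τ = χ - (α ^ 2 - 1 / 4) := by
        rw [hJ, mul_assoc, mul_comm (X ^ 2), hτX, mul_one]
      rw [Real.rpow_sub_one ht'.1.ne', hJτ]
      set Q := (χ - c ^ 2 * t ^ 2 - (α ^ 2 - 1 / 4)) / (1 - t ^ 2) + 1 / (1 - t ^ 2) ^ 2
      have hPt : (1 - τ * t ^ 2) * (1 - τ * t ^ 2 / 2) = P t := rfl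
      rw [hPt, ← hv]
      simp only [Pi.pow_apply, Nat.cast_ofNat, Nat.add_one_sub_one, pow_one, Pi.mul_apply]
      set D := τ * t * (-3 + 2 * (τ * t ^ 2))
      set r := t ^ (2 * α + 1)
      -- completing the square
      have key : 0 ≤ r * ((D - P t * v t) ^ 2 + (Q - (χ - (α ^ 2 - 1 / 4))) * P t ^ 2) :=
        mul_nonneg hr.le (add_nonneg (sq_nonneg _) (mul_nonneg (sub_nonneg.2 hQ) (sq_nonneg _)))
      linear_combination key)
  have hGX : 0 < G X := by
    have hPX : P X = 0 := by simp [hP, hτX]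
    have hr : 0 < X ^ (2 * α + 2) := Real.rpow_pos_of_pos hX0 _
    have : G X = -(τ / 2 * X ^ (2 * α + 2) * trialEnergy α J 1) := by
      simp [hG, hPX, hF, hτX]
    rw [this]
    exact neg_pos.2 (mul_neg_of_pos_of_neg (by positivity) hneg)
  have hGF : ∀ y ∈ Ioc 0 X, G X ≤ -F y := fun y hy => by
    have h1 := h.logDerivative_nonpos hα hχ hX hφ hy
    have h2 : y ^ (2 * α + 1) * P y ^ 2 * v y ≤ 0 :=
      mul_nonpos_of_nonneg_of_nonpos
        (mul_nonneg (Real.rpow_nonneg hy.1.le _) (sq_nonneg _)) h1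
    have h3 := hanti y hy
    simp only [hG] at h3 ⊢
    linarith
  have hlim : Tendsto (fun y => -F y) (𝓝[>] 0) (𝓝 0) := by
    have hc : ContinuousAt (fun y => -F y) 0 := by
      have : ContinuousAt (fun t : ℝ => t ^ (2 * α + 2)) 0 :=
        Real.continuousAt_rpow_const _ _ (Or.inr (by linarith))
      simp only [hF, trialEnergy]
      fun_prop
    have h0 : -F 0 = 0 := by
      simp [hF, Real.zero_rpow (show 2 * α + 2 ≠ 0 by linarith)]
    have := hc.tendsto.mono_left (nhdsWithin_le_nhds (s := Ioi 0))
    rwa [h0] at this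
  have : G X ≤ 0 := ge_of_tendsto hlim (by
    filter_upwards [Ioo_mem_nhdsGT hX0] with y hy using hGF y ⟨hy.1, hy.2.le⟩)
  linarith

end IsSolutionPair

end CircularProlate

theorem mainTheorem8 (α c : ℝ) (hα : 1 / 2 < α) (hc : 0 < c) (n : ℕ) (hn : 1 ≤ n)
    (χ : ℝ) (φ : ℝ → ℝ) (hφ : CircularProlate.IsCPSWF n α c χ φ)
    (hχ : 2 * c * Real.sqrt (α ^ 2 - 1 / 4) ≤ χ) :
    ∃ x₁ : ℝ, IsLeast {x : ℝ | x ∈ Set.Ioo (0 : ℝ) 1 ∧ φ x = 0} x₁ ∧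
      Real.sqrt ((α ^ 2 - 1 / 4) / χ) ≤ x₁ ∧
      (c ^ 2 + α ^ 2 - 1 / 4 ≤ χ →
        x₁ ≤ (Real.pi + Real.pi / 2 * α - 3 / 4) / Real.sqrt (χ - (α ^ 2 - 1 / 4))) := by
  have ha : 0 < α ^ 2 - 1 / 4 := by nlinarith
  have hχ0 : 0 < χ := lt_of_lt_of_le (by positivity) hχ
  obtain ⟨⟨-, hcard⟩, hφ⟩ := hφ
  obtain ⟨M, hM⟩ := hφ.bounded
  have h := hφ.isSolutionPair
  set g : ℝ → ℝ := fun t => (1 - t ^ 2) * deriv φ t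
  obtain ⟨χ', ⟨ψ, hψ⟩, hlt⟩ :
      {χ' ∈ CircularProlate.eigenvalues α c | χ' < χ}.Nonempty := by
    rw [← Set.encard_ne_zero, hcard]
    exact_mod_cast (by omega : n ≠ 0)
  obtain ⟨M', hM'⟩ := hψ.bounded
  obtain ⟨z, hz, hz0⟩ := h.exists_zero hψ.isSolutionPair ha hlt hM hM' hψ.nontrivial
  have hlow : ∀ x ∈ Ioo (0 : ℝ) 1, φ x = 0 → Real.sqrt ((α ^ 2 - 1 / 4) / χ) ≤ x := by
    intro x hx hx0
    rw [Real.sqrt_le_left hx.1.le, div_le_iff₀ hχ0]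
    linarith [h.le_mul_sq_of_eq_zero ha hM hφ.nontrivial hx hx0]
  have hs : 0 < Real.sqrt ((α ^ 2 - 1 / 4) / χ) := by positivity
  set s := Real.sqrt ((α ^ 2 - 1 / 4) / χ)
  have hcompact : IsCompact (Icc s z ∩ φ ⁻¹' {0}) :=
    isCompact_Icc.of_isClosed_subset
      ((h.continuousOn_fst.mono fun x hx => ⟨hs.trans_le hx.1, hx.2.trans_lt hz.2⟩
        ).preimage_isClosed_of_isClosed isClosed_Icc isClosed_singleton) inter_subset_left
  obtain ⟨x₁, ⟨hx₁, hx₁0⟩, hleast⟩ := hcompact.exists_isLeast ⟨z, ⟨hlow z hz hz0, le_rfl⟩, hz0⟩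
  have hx₁mem : x₁ ∈ Ioo (0 : ℝ) 1 := ⟨hs.trans_le hx₁.1, hx₁.2.trans_lt hz.2⟩
  have hleast' : ∀ x ∈ Ioo (0 : ℝ) 1, φ x = 0 → x₁ ≤ x := fun x hx hx0 => by
    rcases le_total x z with hxz | hzx
    · exact hleast ⟨⟨hlow x hx hx0, hxz⟩, hx0⟩
    · exact hx₁.2.trans hzx
  refine ⟨x₁, ⟨⟨hx₁mem, hx₁0⟩, fun x hx => hleast' x hx.1 hx.2⟩, hx₁.1, fun hχ2 => ?_⟩
  have hκ : 0 < χ - (α ^ 2 - 1 / 4) := by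
    have : 0 < c ^ 2 := by positivity
    linarith
  have hκs := Real.sqrt_pos.2 hκ
  set J := Real.pi + Real.pi / 2 * α - 3 / 4 with hJ
  have hJ0 : 0 < J := by nlinarith [Real.pi_gt_three]
  set X := J / Real.sqrt (χ - (α ^ 2 - 1 / 4)) with hX
  have hX0 : 0 < X := by positivity
  rcases lt_or_ge X 1 with hX1 | hX1
  · have hJX : J ^ 2 = (χ - (α ^ 2 - 1 / 4)) * X ^ 2 := by
      rw [hX, div_pow, Real.sq_sqrt hκ.le, ← mul_div_assoc, mul_div_cancel_left₀ _ hκ.ne']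
    obtain ⟨x, hx, hx0⟩ := h.exists_zero_le hα (by linarith) hX0 hX1 hJX
      (CircularProlate.trialEnergy_one_neg hα)
    exact (hleast' x ⟨hx.1, hx.2.trans_lt hX1⟩ hx0).trans hx.2
  · exact hx₁mem.2.le.trans hX1
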